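/- Let $d\ge 1$ and let $\{(\mathbf A_n,\mathbf b_n)\}_{n\ge 1}$ be an i.i.d. sequence of random pairs in $\mathbb R^{d\times d}\times\mathbb R^d$, with $\bar A=\mathbb E[\mathbf A_1]$ and $\bar b=\mathbb E[\mathbf b_1]$, such that: (i) there is $C_b>0$ such that for every unit vector $u\in\mathbb R^d$ and every $\lambda\in\mathbb R$, $\mathbb E[e^{\lambda u^\top(\mathbf b_1-\bar b)}]\le e^{\lambda^2C_b^2/2}$; (ii) there is $C_A>0$ such that $\|\mathbf A_1\|\le C_A$ almost surely, where $\|\cdot\|$ is the spectral norm; (iii) every eigenvalue $\lambda\in\mathbb C$ of $\bar A$ satisfies $\mathrm{Re}(\lambda)>0$. Let $Q$ be the unique symmetric positive definite matrix with $\bar A^\top Q+Q\bar A=\mathrm I$. Put $\|x\|_Q=(x^\top Qx)^{1/2}$, $\|M\|_Q=\max_{\|x\|_Q=1}\|Mx\|_Q$, $\kappa_Q=\lambda_{\max}(Q)/\lambda_{\min}(Q)$, and $$a=\tfrac12\|Q\|^{-1},\qquad \alpha_\infty=\tfrac12\|\bar A\|_Q^{-2}\|Q\|^{-1}.$$ Let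 $\theta^\star$ be the unique solution of $\bar A\theta=\bar b$ and let $\varepsilon_n=\mathbf b_n-\bar b-(\mathbf A_n-\bar A)\theta^\star$. For $\alpha>0$ and $n\ge1$ define $$J_n^{(0)}=\alpha\sum_{j=1}^n G_{j+1:n}\,\varepsilon_j,\qquad G_{j+1:n}=(\mathrm I-\alpha\bar A)^{n-j},\qquad \Sigma_n^\alpha=\mathrm{Cov}(J_n^{(0)}).$$ Then for every $n\ge1$, $\alpha\in(0,\alpha_\infty]$, $u\in\mathbb R^d$ with $\|u\|=1$, and $\delta\in(0,1)$, with probability at least $1-\delta$, $$|u^\top J_n^{(0)}|<D_1\sqrt{\{u^\top\Sigma_n^\alpha u\}\log(2/\delta)}+\alpha\sqrt{1+\log(1/(a\alpha))}\,D_2\log^{3/2}(2/\delta),$$ where $$D_1=60\sqrt3\,e^{4/3},\qquad D_2=540\sqrt3\,e^{1/3}\kappa_Q^{1/2}C_\varepsilon,\qquad C_\varepsilon=\bigl(2C_b^2+8C_A^2\|\theta^\star\|^2\bigr)^{1/2}.$$ -/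

import Mathlib

open MeasureTheory ProbabilityTheory

noncomputable section

namespace LSA

variable {d : ℕ}

/-- The space `ℝ^d` with its Euclidean norm. -/
abbrev Vec (d : ℕ) : Type := EuclideanSpace ℝ (Fin d)

/-- Real `d × d` matrices. -/
abbrev Mat (d : ℕ) : Type := Matrix (Fin d) (Fin d) ℝ

/-- The product (Borel) σ-algebra on matrices. -/
instance instMeasurableSpaceMat (d : ℕ) : MeasurableSpace (Mat d) :=
  inferInstanceAs (MeasurableSpace (Fin d → Fin d → ℝ))

/-- The product `M x` of a matrix and a vector of `ℝ^d`. -/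
def act (M : Mat d) (x : Vec d) : Vec d := Matrix.toEuclideanCLM (𝕜 := ℝ) M x

/-- The spectral norm `‖M‖`. -/
def specNorm (M : Mat d) : ℝ := ‖Matrix.toEuclideanCLM (𝕜 := ℝ) M‖

/-- The weighted norm `‖x‖_Q = (xᵀ Q x)^{1/2}`. -/
def normQ (Q : Mat d) (x : Vec d) : ℝ := Real.sqrt (inner ℝ x (act Q x))

/-- The operator norm `‖M‖_Q = max_{‖x‖_Q = 1} ‖M x‖_Q`. -/
def opNormQ (Q M : Mat d) : ℝ := sSup ((fun x : Vec d => normQ Q (act M x)) '' {x | normQ Q x = 1})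

/-- The condition number `κ_Q = λ_min(Q)⁻¹ λ_max(Q)` of a symmetric positive definite matrix. -/
def condNumber (Q : Mat d) : ℝ := (sInf (spectrum ℝ Q))⁻¹ * sSup (spectrum ℝ Q)

/-- `-M` is Hurwitz: every complex eigenvalue of `M` has positive real part. -/
def IsNegHurwitz (M : Mat d) : Prop :=
  ∀ z : ℂ, Module.End.HasEigenvalue (Matrix.toLin' (M.map (algebraMap ℝ ℂ))) z → 0 < z.re

/-- `Q` is a positive definite solution of the Lyapunov equation `Mᵀ Q + Q M = I`. -/
def IsLyapunovSolution (M Q : Mat d) : Prop :=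
  Q.PosDef ∧ M.transpose * Q + Q * M = 1

open Classical in
/-- The positive definite matrix `Q` with `Mᵀ Q + Q M = I`. It exists and is unique when `-M` is
Hurwitz; the default value `0` is only used for matrices `M` which admit no such `Q`. -/
def lyapunovQ (M : Mat d) : Mat d :=
  if h : ∃ Q : Mat d, IsLyapunovSolution M Q then h.choose else 0

/-- `a = ‖Q‖⁻¹ / 2`. -/
def rateA (M : Mat d) : ℝ := (specNorm (lyapunovQ M))⁻¹ / 2

/-- `α_∞ = (1/2) ‖M‖_Q⁻² ‖Q‖⁻¹`. -/
def alphaInf (M : Mat d) : ℝ :=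
  (1 / 2) * ((opNormQ (lyapunovQ M) M) ^ 2)⁻¹ * (specNorm (lyapunovQ M))⁻¹

variable {Ω : Type*} [MeasurableSpace Ω]

/-- `Ā = E[A_1]`, entrywise. -/
def meanA (μ : Measure Ω) (A : ℕ+ → Ω → Mat d) : Mat d :=
  Matrix.of fun i j => ∫ ω, A 1 ω i j ∂μ

/-- `b̄ = E[b_1]`. -/
def meanB (μ : Measure Ω) (b : ℕ+ → Ω → Vec d) : Vec d := ∫ ω, b 1 ω ∂μ

/-- The standing assumption on the sequence `(A_n, b_n)`, `n ≥ 1`, with constants `C_A` and `C_b`.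
In `subgaussian`, the moment generating function of `uᵀ(b_1 - b̄)` at `t` is finite and at most
`exp (C_b² t² / 2)`, for all real `t`. -/
structure Assumption (μ : Measure Ω) (A : ℕ+ → Ω → Mat d) (b : ℕ+ → Ω → Vec d)
    (CA Cb : ℝ) : Prop where
  measurable_A : ∀ n, Measurable (A n)
  measurable_b : ∀ n, Measurable (b n)
  indep : iIndepFun (fun (n : ℕ+) (ω : Ω) => (A n ω, b n ω)) μ
  identDistrib : ∀ n : ℕ+,
    IdentDistrib (fun ω => (A n ω, b n ω)) (fun ω => (A 1 ω, b 1 ω)) μ μ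
  Cb_pos : 0 < Cb
  subgaussian : ∀ u : Vec d, ‖u‖ = 1 →
    HasSubgaussianMGF (fun ω => inner ℝ u (b 1 ω - meanB μ b)) (Real.toNNReal (Cb ^ 2)) μ
  CA_pos : 0 < CA
  bounded : ∀ᵐ ω ∂μ, specNorm (A 1 ω) ≤ CA
  hurwitz : IsNegHurwitz (meanA μ A)

/-- `θ*`, the solution of `Ā θ = b̄` (the matrix `Ā` is invertible when `-Ā` is Hurwitz). -/
def thetaStar (μ : Measure Ω) (A : ℕ+ → Ω → Mat d) (b : ℕ+ → Ω → Vec d) : Vec d :=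
  act (meanA μ A)⁻¹ (meanB μ b)

/-- The noise `ε_n = b_n - b̄ - (A_n - Ā) θ*`. -/
def noise (μ : Measure Ω) (A : ℕ+ → Ω → Mat d) (b : ℕ+ → Ω → Vec d) (n : ℕ+) (ω : Ω) : Vec d :=
  b n ω - meanB μ b - act (A n ω - meanA μ A) (thetaStar μ A b)

/-- `G_{m:n} = (I - α Ā)^{n-m+1}`, which is `I` for `m = n + 1`. -/
def G (μ : Measure Ω) (A : ℕ+ → Ω → Mat d) (α : ℝ) (m n : ℕ+) : Mat d :=
  (1 - α • meanA μ A) ^ ((n : ℕ) + 1 - (m : ℕ))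

/-- The linear statistic `J_n^{(0)} = α ∑_{j=1}^n G_{j+1:n} ε_j`. -/
def J (μ : Measure Ω) (A : ℕ+ → Ω → Mat d) (b : ℕ+ → Ω → Vec d) (α : ℝ) (n : ℕ+) (ω : Ω) :
    Vec d :=
  α • ∑ j ∈ Finset.Icc 1 n, act (G μ A α (j + 1) n) (noise μ A b j ω)

/-- The covariance matrix `Σ_n^α = Cov(J_n^{(0)})`. -/
def covJ (μ : Measure Ω) (A : ℕ+ → Ω → Mat d) (b : ℕ+ → Ω → Vec d) (α : ℝ) (n : ℕ+) : Mat d :=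
  Matrix.of fun i k => cov[fun ω => J μ A b α n ω i, fun ω => J μ A b α n ω k; μ]

/-- `C_ε = (2 C_b² + 8 C_A² ‖θ*‖²)^{1/2}`. -/
def Ceps (μ : Measure Ω) (A : ℕ+ → Ω → Mat d) (b : ℕ+ → Ω → Vec d) (CA Cb : ℝ) : ℝ :=
  Real.sqrt (2 * Cb ^ 2 + 8 * CA ^ 2 * ‖thetaStar μ A b‖ ^ 2)

/-- `D₁ = 60 √3 e^{4/3}`. -/
def D1 : ℝ := 60 * Real.sqrt 3 * Real.exp (4 / 3)

/-- `D₂ = 540 √3 e^{1/3} κ_Q^{1/2} C_ε`. -/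
def D2 (μ : Measure Ω) (A : ℕ+ → Ω → Mat d) (b : ℕ+ → Ω → Vec d) (CA Cb : ℝ) : ℝ :=
  540 * Real.sqrt 3 * Real.exp (1 / 3) * Real.sqrt (condNumber (lyapunovQ (meanA μ A))) *
    Ceps μ A b CA Cb

end LSA

end

/-! For fixed `u`, the scalar `uᵀJ` is a sum of independent centered terms `⟨v_j, ε_j⟩` with `v_j =
α G_{j+1:n}ᵀ u`, and the sum of their second moments is exactly `uᵀ Σ u`. Each term is sub-Gaussian.
Contraction of `I - αĀ` in the `Q`-norm makes its variance proxy at most `c² exp(-r(n-j))`, where `c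
= α κ_Q^{1/2} C_ε` and `r = aα`.

The terms are truncated at one common level `M = c √(2t)`. Since the proxies decay geometrically,
the tail probabilities sum to `O(e^{-t}/r)` uniformly in `n`, so `t ≈ log(1/r) + log(2/δ)` suffices;
this is the source of the factor `√(1 + log(1/(aα)))`. Bernstein's inequality for the truncated sum
(`measureReal_abs_sum_ge_le`) gives a deviation `4√(sV) + 4sM` with `s ≈ log(2/δ)`, and `s√t`
accounts for the power `3/2`.

The inputs are `norm_act_pow_transpose_sq_le` (stability), `Assumption.inner_noise_subgaussian`
(noise), `Assumption.sum_integral_sq` (variance) and Lyapunov's theorem, which ensures that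
`lyapunovQ` is a genuine solution. The last is obtained from a Stein equation through the Cayley
transform. -/

namespace LSA

/-! ### Bernstein's inequality by truncation. -/

section Concentration

variable {Ω : Type*} [MeasurableSpace Ω] {μ : Measure Ω} [IsProbabilityMeasure μ]

/-- A bounded random variable has `mgf Y t ≤ exp (t E[Y] + t² E[Y²])` for small `t`. -/
lemma mgf_le_exp_of_abs_le {Y : Ω → ℝ} {M t : ℝ} (hY : AEStronglyMeasurable Y μ)
    (hM : ∀ ω, |Y ω| ≤ M) (ht : 0 ≤ t) (htM : t * M ≤ 1) :
    mgf Y μ t ≤ Real.exp (t * ∫ ω, Y ω ∂μ + t ^ 2 * ∫ ω, Y ω ^ 2 ∂μ) := by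
  have hint : Integrable Y μ := Integrable.of_bound hY M (ae_of_all _ hM)
  have hint2 : Integrable (fun ω => Y ω ^ 2) μ := by
    refine Integrable.of_bound (hY.pow 2) (M ^ 2) (ae_of_all _ fun ω => ?_)
    rw [Real.norm_eq_abs, abs_pow]
    exact pow_le_pow_left₀ (abs_nonneg _) (hM ω) 2
  have hpt : ∀ ω, Real.exp (t * Y ω) ≤ 1 + t * Y ω + t ^ 2 * Y ω ^ 2 := fun ω => by
    have h1 : |t * Y ω| ≤ 1 := by
      rw [abs_mul, abs_of_nonneg ht]
      exact (mul_le_mul_of_nonneg_left (hM ω) ht).trans htM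
    have h2 := (abs_le.1 (Real.abs_exp_sub_one_sub_id_le h1)).2
    rw [mul_pow] at h2
    linarith
  calc mgf Y μ t = ∫ ω, Real.exp (t * Y ω) ∂μ := rfl
    _ ≤ ∫ ω, (1 + t * Y ω + t ^ 2 * Y ω ^ 2) ∂μ := by
        refine integral_mono_of_nonneg (ae_of_all _ fun ω => (Real.exp_pos _).le) ?_
          (ae_of_all _ hpt)
        exact ((integrable_const _).add (hint.const_mul t)).add (hint2.const_mul (t ^ 2))
    _ = t * ∫ ω, Y ω ∂μ + t ^ 2 * ∫ ω, Y ω ^ 2 ∂μ + 1 := by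
        have h1 : Integrable (fun ω => 1 + t * Y ω) μ := (integrable_const _).add (hint.const_mul t)
        rw [integral_add h1 (hint2.const_mul _), integral_add (integrable_const _)
          (hint.const_mul t), integral_const_mul, integral_const_mul]
        simp
        ring
    _ ≤ _ := Real.add_one_le_exp _

/-- Chernoff's bound for a sum of bounded independent random variables. -/
lemma measureReal_sum_ge_le_of_abs_le {ι : Type*} {Y : ι → Ω → ℝ} {S : Finset ι} {M t s V : ℝ}
    (hind : iIndepFun Y μ) (hY : ∀ i, AEMeasurable (Y i) μ) (hM : ∀ i ω, |Y i ω| ≤ M)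
    (ht : 0 < t) (htM : t * M ≤ 1) (hV : ∑ i ∈ S, ∫ ω, Y i ω ^ 2 ∂μ ≤ V) :
    μ.real {ω | ∑ i ∈ S, ∫ ω, Y i ω ∂μ + t * V + s / t ≤ ∑ i ∈ S, Y i ω} ≤ Real.exp (-s) := by
  have hmgf : mgf (∑ i ∈ S, Y i) μ t ≤ Real.exp (t * ∑ i ∈ S, ∫ ω, Y i ω ∂μ + t ^ 2 * V) := by
    rw [hind.mgf_sum₀ hY]
    calc ∏ i ∈ S, mgf (Y i) μ t
        ≤ ∏ i ∈ S, Real.exp (t * ∫ ω, Y i ω ∂μ + t ^ 2 * ∫ ω, Y i ω ^ 2 ∂μ) :=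
          Finset.prod_le_prod (fun _ _ => mgf_nonneg) fun i _ =>
            mgf_le_exp_of_abs_le (hY i).aestronglyMeasurable (hM i) ht.le htM
      _ = Real.exp (t * ∑ i ∈ S, ∫ ω, Y i ω ∂μ + t ^ 2 * ∑ i ∈ S, ∫ ω, Y i ω ^ 2 ∂μ) := by
          rw [← Real.exp_sum, Finset.sum_add_distrib, Finset.mul_sum, Finset.mul_sum]
      _ ≤ _ := by gcongr
  have hint : Integrable (fun ω => Real.exp (t * (∑ i ∈ S, Y i) ω)) μ := by
    refine Integrable.of_bound (C := Real.exp (t * (S.card * M))) ?_ (ae_of_all _ fun ω => ?_)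
    · have : AEMeasurable (∑ i ∈ S, Y i) μ := Finset.aemeasurable_sum S fun i _ => hY i
      exact (Real.measurable_exp.comp_aemeasurable (this.const_mul t)).aestronglyMeasurable
    · rw [Real.norm_eq_abs, Real.abs_exp, Finset.sum_apply]
      gcongr
      calc ∑ i ∈ S, Y i ω ≤ ∑ _i ∈ S, M := Finset.sum_le_sum fun i _ => (abs_le.1 (hM i ω)).2
        _ = S.card * M := by simp
  have hch := measure_ge_le_exp_mul_mgf (μ := μ) (X := ∑ i ∈ S, Y i)
    (∑ i ∈ S, ∫ ω, Y i ω ∂μ + t * V + s / t) ht.le hint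
  simp only [Finset.sum_apply] at hch
  refine hch.trans ((mul_le_mul_of_nonneg_left hmgf (Real.exp_pos _).le).trans_eq ?_)
  rw [← Real.exp_add]
  congr 1
  field_simp
  ring

/-- The mean of a truncated centered variable. -/
lemma abs_integral_truncation_le {X : Ω → ℝ} {M t : ℝ} (hX : MemLp X 2 μ)
    (h0 : ∫ ω, X ω ∂μ = 0) (ht : 0 < t) :
    |∫ ω, truncation X M ω ∂μ| ≤ t * ∫ ω, X ω ^ 2 ∂μ + μ.real {ω | M ≤ |X ω|} / t := by
  have hXi : Integrable X μ := hX.integrable (by norm_num)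
  have hTi : Integrable (truncation X M) μ := (hX.aestronglyMeasurable.integrable_truncation)
  have hset : NullMeasurableSet {ω | M ≤ |X ω|} μ :=
    nullMeasurableSet_le aemeasurable_const hXi.aemeasurable.norm
  -- The error vanishes where `|X| < M`; elsewhere it is at most `|X| ≤ t X² + 1/t`. This form has
  -- the same shape as the Chernoff terms, so the same `t` serves both.
  have hpt : ∀ ω, |X ω - truncation X M ω|
      ≤ t * X ω ^ 2 + ({ω | M ≤ |X ω|}.indicator (fun _ => (1 : ℝ)) ω) / t := fun ω => by
    by_cases h : M ≤ |X ω|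
    · have h1 : |X ω - truncation X M ω| ≤ |X ω| := by
        simp only [truncation, Function.comp, Set.indicator]
        split_ifs <;> simp
      rw [Set.indicator_of_mem (by exact h)]
      have h2 : |X ω| ≤ t * X ω ^ 2 + 1 / t := by
        rw [← sq_abs (X ω), ← sub_nonneg]
        have : t * |X ω| ^ 2 + 1 / t - |X ω|
            = ((t * |X ω| - 1 / 2) ^ 2 + 3 / 4) / t := by field_simp; ring
        rw [this]; positivity
      exact h1.trans h2
    · have : truncation X M ω = X ω := truncation_eq_self (not_le.1 h)
      rw [this, sub_self, abs_zero]
      have : 0 ≤ {ω | M ≤ |X ω|}.indicator (fun _ => (1 : ℝ)) ω :=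
        Set.indicator_nonneg (fun _ _ => zero_le_one) _
      positivity
  have hind : Integrable ({ω | M ≤ |X ω|}.indicator (fun _ => (1 : ℝ))) μ :=
    (integrable_const (1 : ℝ)).indicator₀ hset
  calc |∫ ω, truncation X M ω ∂μ| = |∫ ω, (X ω - truncation X M ω) ∂μ| := by
        rw [integral_sub hXi hTi, h0, zero_sub, abs_neg]
    _ ≤ ∫ ω, |X ω - truncation X M ω| ∂μ := abs_integral_le_integral_abs
    _ ≤ ∫ ω, (t * X ω ^ 2 + ({ω | M ≤ |X ω|}.indicator (fun _ => (1 : ℝ)) ω) / t) ∂μ :=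
        integral_mono (hXi.sub hTi).abs ((hX.integrable_sq.const_mul t).add (hind.div_const t)) hpt
    _ = _ := by
        rw [integral_add (hX.integrable_sq.const_mul t) (hind.div_const t), integral_const_mul,
          integral_div, integral_indicator₀ hset]
        simp

/-- Bernstein's inequality for the upper tail of a sum of truncated independent variables. -/
lemma measureReal_sum_truncation_ge_le {ι : Type*} {X : ι → Ω → ℝ} {S : Finset ι} {M s V : ℝ}
    (hind : iIndepFun X μ) (hX : ∀ i, MemLp (X i) 2 μ) (h0 : ∀ i, ∫ ω, X i ω ∂μ = 0)
    (hM : 0 < M) (hs : 0 < s) (hV : ∑ i ∈ S, ∫ ω, X i ω ^ 2 ∂μ = V)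
    (htail : ∑ i ∈ S, μ.real {ω | M ≤ |X i ω|} ≤ s) :
    μ.real {ω | 4 * Real.sqrt (s * V) + 4 * s * M ≤ ∑ i ∈ S, truncation (X i) M ω}
      ≤ Real.exp (-s) := by
  have hV0 : 0 ≤ V := hV ▸ Finset.sum_nonneg fun i _ => integral_nonneg fun ω => sq_nonneg _
  have hmeasX : ∀ i, AEMeasurable (X i) μ := fun i => (hX i).aemeasurable
  have hYm : ∀ i, AEMeasurable (truncation (X i) M) μ := fun i =>
    ((hX i).aestronglyMeasurable.truncation).aemeasurable
  have hYind : iIndepFun (fun i => truncation (X i) M) μ :=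
    hind.comp (fun _ => (Set.Ioc (-M) M).indicator id)
      fun _ => measurable_id.indicator measurableSet_Ioc
  have hbd : ∀ i ω, |truncation (X i) M ω| ≤ M := fun i ω =>
    (abs_truncation_le_bound _ _ _).trans_eq (abs_of_pos hM)
  have hV' : ∑ i ∈ S, ∫ ω, truncation (X i) M ω ^ 2 ∂μ ≤ V := by
    rw [← hV]
    refine Finset.sum_le_sum fun i _ => integral_mono_of_nonneg
      (ae_of_all _ fun ω => sq_nonneg _) (hX i).integrable_sq (ae_of_all _ fun ω => ?_)
    exact sq_le_sq.2 (abs_truncation_le_abs_self _ _ _)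
  -- `t` is the smaller of the unconstrained optimum `√(s/V)` and the cap `1/M` required by the mgf
  -- bound. The factor 2 is there because the truncation bias and the Chernoff deviation each cost
  -- `tV + s/t`.
  obtain ⟨t, ht, htM, hbound⟩ : ∃ t : ℝ, 0 < t ∧ t * M ≤ 1 ∧
      2 * (t * V + s / t) ≤ 4 * Real.sqrt (s * V) + 4 * s * M := by
    by_cases hc : s * M ^ 2 ≤ V
    · have hVpos : 0 < V := lt_of_lt_of_le (by positivity) hc
      refine ⟨Real.sqrt (s / V), by positivity, ?_, ?_⟩
      · rw [← Real.sqrt_sq hM.le, ← Real.sqrt_mul (by positivity), Real.sqrt_le_one,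
          div_mul_eq_mul_div, div_le_one hVpos]
        exact hc
      · have h1 : Real.sqrt (s / V) * V = Real.sqrt (s * V) := by
          rw [show s * V = s / V * V ^ 2 by field_simp, Real.sqrt_mul (by positivity),
            Real.sqrt_sq hV0]
        have h2 : s / Real.sqrt (s / V) = Real.sqrt (s * V) := by
          rw [div_eq_iff (by positivity), ← Real.sqrt_mul (by positivity),
            show s * V * (s / V) = s ^ 2 by field_simp, Real.sqrt_sq hs.le]
        rw [h1, h2]
        have : 0 ≤ s * M := by positivity
        linarith
    · refine ⟨1 / M, by positivity, by field_simp; rfl, ?_⟩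
      have h1 : 1 / M * V ≤ s * M := by
        rw [one_div_mul_eq_div, div_le_iff₀ hM]
        nlinarith
      have h2 : s / (1 / M) = s * M := by field_simp
      rw [h2]
      linarith [Real.sqrt_nonneg (s * V)]
  have hmean : ∑ i ∈ S, ∫ ω, truncation (X i) M ω ∂μ ≤ t * V + s / t := by
    calc ∑ i ∈ S, ∫ ω, truncation (X i) M ω ∂μ
        ≤ ∑ i ∈ S, (t * ∫ ω, X i ω ^ 2 ∂μ + μ.real {ω | M ≤ |X i ω|} / t) :=
          Finset.sum_le_sum fun i _ =>
            (le_abs_self _).trans (abs_integral_truncation_le (hX i) (h0 i) ht)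
      _ = t * V + (∑ i ∈ S, μ.real {ω | M ≤ |X i ω|}) / t := by
          rw [Finset.sum_add_distrib, ← Finset.mul_sum, hV, Finset.sum_div]
      _ ≤ _ := by gcongr
  refine (measureReal_mono fun ω hω => ?_).trans
    (measureReal_sum_ge_le_of_abs_le (s := s) (S := S) hYind hYm hbd ht htM hV')
  simp only [Set.mem_ofPred_eq] at hω ⊢
  linarith

/-- A Bernstein inequality for sums of independent, centered, square integrable variables. -/
lemma measureReal_abs_sum_ge_le {ι : Type*} {X : ι → Ω → ℝ} {S : Finset ι} {M s V τ : ℝ}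
    (hind : iIndepFun X μ) (hX : ∀ i, MemLp (X i) 2 μ) (h0 : ∀ i, ∫ ω, X i ω ∂μ = 0)
    (hM : 0 < M) (hs : 0 < s) (hV : ∑ i ∈ S, ∫ ω, X i ω ^ 2 ∂μ = V)
    (htail : ∑ i ∈ S, μ.real {ω | M ≤ |X i ω|} ≤ τ) (hτ : τ ≤ s) :
    μ.real {ω | 4 * Real.sqrt (s * V) + 4 * s * M ≤ |∑ i ∈ S, X i ω|}
      ≤ τ + 2 * Real.exp (-s) := by
  set T := 4 * Real.sqrt (s * V) + 4 * s * M with hT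
  have hup := measureReal_sum_truncation_ge_le hind hX h0 hM hs hV (htail.trans hτ)
  have hlow := measureReal_sum_truncation_ge_le (X := fun i ω => -X i ω) (S := S) (V := V)
    (hind.comp (fun _ x => -x) fun _ => measurable_neg) (fun i => (hX i).neg)
    (fun i => by rw [integral_neg, h0 i, neg_zero]) hM hs (by simpa using hV)
    (by simpa using htail.trans hτ)
  rw [← hT] at hup hlow
  -- Unless some term reaches `M`, truncation changes nothing. The lower tail truncates `-X i` anew,
  -- because `truncation` uses a half-open interval and is not odd.
  have hsub : {ω | T ≤ |∑ i ∈ S, X i ω|} ⊆ (⋃ i ∈ S, {ω | M ≤ |X i ω|}) ∪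
      ({ω | T ≤ ∑ i ∈ S, truncation (X i) M ω} ∪
        {ω | T ≤ ∑ i ∈ S, truncation (fun ω => -X i ω) M ω}) := fun ω hω => by
    simp only [Set.mem_union, Set.mem_iUnion, Set.mem_ofPred_eq, exists_prop] at hω ⊢
    by_cases h : ∃ i ∈ S, M ≤ |X i ω|
    · exact Or.inl h
    · push Not at h
      refine Or.inr ((le_abs.1 hω).imp (fun h' => ?_) fun h' => ?_)
      · rwa [Finset.sum_congr rfl fun i hi => truncation_eq_self (h i hi)]
      · rw [Finset.sum_congr rfl fun i hi =>
          truncation_eq_self (f := fun ω => -X i ω) (by simpa using h i hi)]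
        simpa using h'
  calc μ.real {ω | T ≤ |∑ i ∈ S, X i ω|}
      ≤ μ.real (⋃ i ∈ S, {ω | M ≤ |X i ω|}) +
        (μ.real {ω | T ≤ ∑ i ∈ S, truncation (X i) M ω} +
          μ.real {ω | T ≤ ∑ i ∈ S, truncation (fun ω => -X i ω) M ω}) :=
        (measureReal_mono hsub).trans ((measureReal_union_le _ _).trans
          (add_le_add le_rfl (measureReal_union_le _ _)))
    _ ≤ τ + (Real.exp (-s) + Real.exp (-s)) :=
        add_le_add ((measureReal_biUnion_finset_le _ _).trans htail) (add_le_add hup hlow)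
    _ = _ := by ring

end Concentration

end LSA

namespace LSA

/-! ### Contraction of `I - αM` in the weighted norm. -/

section LinearAlgebra

variable {d : ℕ}

lemma act_mul (M N : Mat d) (x : Vec d) : act (M * N) x = act M (act N x) := by
  simp [act]

lemma act_one (x : Vec d) : act 1 x = x := by
  simp [act]

lemma act_add (M N : Mat d) (x : Vec d) : act (M + N) x = act M x + act N x := by
  simp [act]

lemma act_sub (M N : Mat d) (x : Vec d) : act (M - N) x = act M x - act N x := by
  simp [act]

lemma act_smul (c : ℝ) (M : Mat d) (x : Vec d) : act (c • M) x = c • act M x := by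
  simp [act]

lemma inner_act_transpose (M : Mat d) (x y : Vec d) :
    inner ℝ (act M.transpose x) y = inner ℝ x (act M y) := by
  have h : Matrix.toEuclideanCLM (𝕜 := ℝ) M.transpose
      = ContinuousLinearMap.adjoint (Matrix.toEuclideanCLM (𝕜 := ℝ) M) := by
    rw [← ContinuousLinearMap.star_eq_adjoint, ← map_star, Matrix.star_eq_conjTranspose,
      Matrix.conjTranspose_eq_transpose_of_trivial]
  rw [act, h, ContinuousLinearMap.adjoint_inner_left, act]

lemma norm_act_le (M : Mat d) (x : Vec d) : ‖act M x‖ ≤ specNorm M * ‖x‖ :=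
  ContinuousLinearMap.le_opNorm _ x

lemma specNorm_nonneg (M : Mat d) : 0 ≤ specNorm M := norm_nonneg _

lemma inner_act_nonneg {Q : Mat d} (hQ : Q.PosSemidef) (x : Vec d) : 0 ≤ inner ℝ x (act Q x) := by
  have := hQ.dotProduct_mulVec_nonneg (x.ofLp)
  simpa [act, PiLp.inner_apply, dotProduct, mul_comm, Matrix.ofLp_toEuclideanCLM] using this

lemma inner_act_le (Q : Mat d) (x : Vec d) : inner ℝ x (act Q x) ≤ specNorm Q * ‖x‖ ^ 2 := by
  calc inner ℝ x (act Q x) ≤ ‖x‖ * ‖act Q x‖ := real_inner_le_norm _ _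
    _ ≤ ‖x‖ * (specNorm Q * ‖x‖) := by gcongr; exact norm_act_le Q x
    _ = _ := by ring

open scoped MatrixOrder in
lemma inner_act_ge_of_forall_spectrum {Q : Mat d} (hQ : Q.IsHermitian) {c : ℝ}
    (h : ∀ r ∈ spectrum ℝ Q, c ≤ r) (x : Vec d) : c * ‖x‖ ^ 2 ≤ inner ℝ x (act Q x) := by
  have hle : algebraMap ℝ (Mat d) c ≤ Q :=
    (algebraMap_le_iff_le_spectrum (a := Q) (ha := hQ.isSelfAdjoint)).2 h
  have := inner_act_nonneg (Matrix.le_iff.1 hle) x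
  rw [Algebra.algebraMap_eq_smul_one, act_sub, act_smul, act_one, inner_sub_right,
    inner_smul_right, real_inner_self_eq_norm_sq] at this
  linarith

open scoped MatrixOrder in
lemma inner_act_le_of_forall_spectrum {Q : Mat d} (hQ : Q.IsHermitian) {c : ℝ}
    (h : ∀ r ∈ spectrum ℝ Q, r ≤ c) (x : Vec d) : inner ℝ x (act Q x) ≤ c * ‖x‖ ^ 2 := by
  have hle : Q ≤ algebraMap ℝ (Mat d) c :=
    (le_algebraMap_iff_spectrum_le (a := Q) (ha := hQ.isSelfAdjoint)).2 h
  have := inner_act_nonneg (Matrix.le_iff.1 hle) x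
  rw [Algebra.algebraMap_eq_smul_one, act_sub, act_smul, act_one, inner_sub_right,
    inner_smul_right, real_inner_self_eq_norm_sq] at this
  linarith

lemma finite_spectrum {Q : Mat d} (hQ : Q.IsHermitian) : (spectrum ℝ Q).Finite := by
  rw [hQ.spectrum_real_eq_range_eigenvalues]
  exact Set.finite_range _

lemma sInf_spectrum_pos [Nonempty (Fin d)] {Q : Mat d} (hQ : Q.PosDef) :
    0 < sInf (spectrum ℝ Q) := by
  have hne : (spectrum ℝ Q).Nonempty := by
    rw [hQ.1.spectrum_real_eq_range_eigenvalues]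
    exact Set.range_nonempty _
  have hmem := hne.csInf_mem (finite_spectrum hQ.1)
  rw [hQ.1.spectrum_real_eq_range_eigenvalues] at hmem ⊢
  obtain ⟨i, hi⟩ := hmem
  rw [← hi]
  exact hQ.eigenvalues_pos i

lemma sInf_spectrum_mul_le {Q : Mat d} (hQ : Q.PosDef) (x : Vec d) :
    sInf (spectrum ℝ Q) * ‖x‖ ^ 2 ≤ inner ℝ x (act Q x) :=
  inner_act_ge_of_forall_spectrum hQ.1 (fun _ hr => csInf_le (finite_spectrum hQ.1).bddBelow hr) x

lemma le_sSup_spectrum_mul {Q : Mat d} (hQ : Q.PosDef) (x : Vec d) :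
    inner ℝ x (act Q x) ≤ sSup (spectrum ℝ Q) * ‖x‖ ^ 2 :=
  inner_act_le_of_forall_spectrum hQ.1 (fun _ hr => le_csSup (finite_spectrum hQ.1).bddAbove hr) x

lemma sSup_spectrum_pos [Nonempty (Fin d)] {Q : Mat d} (hQ : Q.PosDef) :
    0 < sSup (spectrum ℝ Q) := by
  refine (sInf_spectrum_pos hQ).trans_le (csInf_le_csSup ?_ (finite_spectrum hQ.1).bddBelow
    (finite_spectrum hQ.1).bddAbove)
  rw [hQ.1.spectrum_real_eq_range_eigenvalues]
  exact Set.range_nonempty _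

lemma condNumber_pos [Nonempty (Fin d)] {Q : Mat d} (hQ : Q.PosDef) : 0 < condNumber Q :=
  mul_pos (inv_pos.2 (sInf_spectrum_pos hQ)) (sSup_spectrum_pos hQ)

lemma normQ_nonneg (Q : Mat d) (x : Vec d) : 0 ≤ normQ Q x := Real.sqrt_nonneg _

lemma normQ_sq {Q : Mat d} (hQ : Q.PosDef) (x : Vec d) :
    normQ Q x ^ 2 = inner ℝ x (act Q x) :=
  Real.sq_sqrt (inner_act_nonneg hQ.posSemidef x)

lemma normQ_smul (Q : Mat d) (c : ℝ) (x : Vec d) : normQ Q (c • x) = |c| * normQ Q x := by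
  rw [normQ, normQ, ← Real.sqrt_sq_eq_abs, ← Real.sqrt_mul (sq_nonneg c)]
  simp only [act, map_smul, inner_smul_left, inner_smul_right]
  congr 1
  simp
  ring

lemma normQ_act_le [Nonempty (Fin d)] {Q : Mat d} (hQ : Q.PosDef) (M : Mat d) (x : Vec d) :
    normQ Q (act M x) ≤ opNormQ Q M * normQ Q x := by
  have hmin := sInf_spectrum_pos hQ
  have hmax := sSup_spectrum_pos hQ
  -- The supremum defining `opNormQ` bounds its members only once the set is known to be bounded
  -- above; equivalence of `normQ` with the Euclidean norm provides this.
  have hbdd : BddAbove ((fun x : Vec d => normQ Q (act M x)) '' {x | normQ Q x = 1}) := by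
    refine ⟨Real.sqrt (sSup (spectrum ℝ Q) * (specNorm M ^ 2 * (sInf (spectrum ℝ Q))⁻¹)), ?_⟩
    rintro _ ⟨y, hy, rfl⟩
    have hy1 : inner ℝ y (act Q y) = 1 := by
      rw [← normQ_sq hQ, show normQ Q y = 1 from hy, one_pow]
    have hy2 : ‖y‖ ^ 2 ≤ (sInf (spectrum ℝ Q))⁻¹ := by
      rw [inv_eq_one_div, le_div_iff₀ hmin, mul_comm, ← hy1]
      exact sInf_spectrum_mul_le hQ y
    refine Real.sqrt_le_sqrt ((le_sSup_spectrum_mul hQ _).trans ?_)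
    gcongr
    calc ‖act M y‖ ^ 2 ≤ (specNorm M * ‖y‖) ^ 2 := by gcongr; exact norm_act_le M y
      _ = specNorm M ^ 2 * ‖y‖ ^ 2 := by ring
      _ ≤ _ := by gcongr
  rcases eq_or_ne x 0 with rfl | hx
  · simp [act, normQ]
  have hpos : 0 < normQ Q x := by
    refine Real.sqrt_pos.2 (lt_of_lt_of_le ?_ (sInf_spectrum_mul_le hQ x))
    have := norm_pos_iff.2 hx
    positivity
  have hmem : normQ Q (act M ((normQ Q x)⁻¹ • x)) ≤ opNormQ Q M := by
    refine le_csSup hbdd ⟨_, ?_, rfl⟩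
    change normQ Q _ = 1
    rw [normQ_smul, abs_of_pos (inv_pos.2 hpos), inv_mul_cancel₀ hpos.ne']
  rw [show act M ((normQ Q x)⁻¹ • x) = (normQ Q x)⁻¹ • act M x by simp [act], normQ_smul,
    abs_of_pos (inv_pos.2 hpos), inv_mul_le_iff₀ hpos, mul_comm] at hmem
  exact hmem

/-- One step of `I - α M` contracts the weighted norm when `α` is small. -/
lemma normQ_act_one_sub_sq_le [Nonempty (Fin d)] {M Q : Mat d} (hQ : IsLyapunovSolution M Q)
    {α : ℝ} (hα : 0 ≤ α) (hle : α * opNormQ Q M ^ 2 ≤ (specNorm Q)⁻¹ / 2) (x : Vec d) :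
    normQ Q (act (1 - α • M) x) ^ 2 ≤ (1 - (specNorm Q)⁻¹ / 2 * α) * normQ Q x ^ 2 := by
  have hsymm : ∀ y z : Vec d, inner ℝ (act Q y) z = inner ℝ y (act Q z) := fun y z => by
    rw [← inner_act_transpose, show Q.transpose = Q by
      simpa [Matrix.IsHermitian, Matrix.conjTranspose_eq_transpose_of_trivial] using hQ.1.1]
  -- The Lyapunov equation turns the cross term of `‖x - αMx‖_Q²` into `-α‖x‖²`. Half of the
  -- resulting decrease absorbs the quadratic term in `α`, by `hle`.
  have hlyap : 2 * inner ℝ x (act Q (act M x)) = ‖x‖ ^ 2 := by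
    have h := congrArg (fun N => inner ℝ x (act N x)) hQ.2
    simp only [act_add, act_mul, act_one, inner_add_right, real_inner_self_eq_norm_sq] at h
    rw [← real_inner_comm, inner_act_transpose, hsymm] at h
    linarith
  have hexp : normQ Q (act (1 - α • M) x) ^ 2
      = normQ Q x ^ 2 - α * ‖x‖ ^ 2 + α ^ 2 * normQ Q (act M x) ^ 2 := by
    have hact : act Q (x - α • act M x) = act Q x - α • act Q (act M x) := by simp [act]
    have hsw : inner ℝ (act M x) (act Q x) = inner ℝ x (act Q (act M x)) := by
      rw [← hsymm, real_inner_comm]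
    rw [normQ_sq hQ.1, normQ_sq hQ.1, normQ_sq hQ.1, act_sub, act_one, act_smul, hact]
    simp only [inner_sub_left, inner_sub_right, real_inner_smul_left, real_inner_smul_right]
    rw [hsw, ← hlyap]
    ring
  have hnorm : (specNorm Q)⁻¹ * normQ Q x ^ 2 ≤ ‖x‖ ^ 2 := by
    rw [normQ_sq hQ.1]
    rcases (specNorm_nonneg Q).eq_or_lt with h0 | hpos
    · rw [← h0]; simp
    · rw [inv_mul_le_iff₀ hpos]
      exact inner_act_le Q x
  have hM : normQ Q (act M x) ^ 2 ≤ opNormQ Q M ^ 2 * normQ Q x ^ 2 := by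
    rw [← mul_pow]
    exact pow_le_pow_left₀ (normQ_nonneg _ _) (normQ_act_le hQ.1 M x) 2
  rw [hexp]
  calc normQ Q x ^ 2 - α * ‖x‖ ^ 2 + α ^ 2 * normQ Q (act M x) ^ 2
      ≤ normQ Q x ^ 2 - α * ((specNorm Q)⁻¹ * normQ Q x ^ 2)
        + α * (α * opNormQ Q M ^ 2) * normQ Q x ^ 2 := by
        have : α ^ 2 * normQ Q (act M x) ^ 2 ≤ α ^ 2 * (opNormQ Q M ^ 2 * normQ Q x ^ 2) := by
          gcongr
        nlinarith [mul_le_mul_of_nonneg_left hnorm hα]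
    _ ≤ normQ Q x ^ 2 - α * ((specNorm Q)⁻¹ * normQ Q x ^ 2)
        + α * ((specNorm Q)⁻¹ / 2) * normQ Q x ^ 2 := by gcongr
    _ = _ := by ring

/-- At any nonzero vector the contraction inequality bounds a square by `1 - r` times a positive
number, so `1 - r` cannot be negative. -/
lemma rate_mul_le_one [Nonempty (Fin d)] {M Q : Mat d} (hQ : IsLyapunovSolution M Q)
    {α : ℝ} (hα : 0 ≤ α) (hle : α * opNormQ Q M ^ 2 ≤ (specNorm Q)⁻¹ / 2) :
    (specNorm Q)⁻¹ / 2 * α ≤ 1 := by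
  obtain ⟨x, hx⟩ := exists_ne (0 : Vec d)
  have hpos : 0 < normQ Q x ^ 2 := by
    rw [normQ_sq hQ.1]
    have h1 := norm_pos_iff.2 hx
    have h2 := sInf_spectrum_pos hQ.1
    exact lt_of_lt_of_le (by positivity) (sInf_spectrum_mul_le hQ.1 x)
  have h := (sq_nonneg _).trans (normQ_act_one_sub_sq_le hQ hα hle x)
  have := nonneg_of_mul_nonneg_left h hpos
  linarith

/-- Exponential stability of the powers of `I - α M`. -/
lemma norm_act_pow_transpose_sq_le [Nonempty (Fin d)] {M Q : Mat d}
    (hQ : IsLyapunovSolution M Q) {α : ℝ} (hα : 0 ≤ α)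
    (hle : α * opNormQ Q M ^ 2 ≤ (specNorm Q)⁻¹ / 2) (k : ℕ) (u : Vec d) :
    ‖act ((1 - α • M) ^ k).transpose u‖ ^ 2
      ≤ condNumber Q * Real.exp (-((specNorm Q)⁻¹ / 2 * α * k)) * ‖u‖ ^ 2 := by
  set r := (specNorm Q)⁻¹ / 2 * α with hr
  have hmin := sInf_spectrum_pos hQ.1
  have hpow : ∀ (k : ℕ) (x : Vec d),
      normQ Q (act ((1 - α • M) ^ k) x) ^ 2 ≤ Real.exp (-(r * k)) * normQ Q x ^ 2 := by
    intro k
    induction k with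
    | zero => intro x; simp [act_one]
    | succ k ih =>
      intro x
      rw [pow_succ (1 - α • M), act_mul]
      calc _ ≤ Real.exp (-(r * k)) * normQ Q (act (1 - α • M) x) ^ 2 := ih _
        _ ≤ Real.exp (-(r * k)) * ((1 - r) * normQ Q x ^ 2) := by
            gcongr; exact normQ_act_one_sub_sq_le hQ hα hle x
        _ ≤ Real.exp (-(r * k)) * (Real.exp (-r) * normQ Q x ^ 2) := by
            gcongr; exact Real.one_sub_le_exp_neg r
        _ = _ := by
            rw [← mul_assoc, ← Real.exp_add]
            push_cast
            ring_nf
  have hbd : ∀ x : Vec d, ‖act ((1 - α • M) ^ k) x‖ ^ 2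
      ≤ condNumber Q * Real.exp (-(r * k)) * ‖x‖ ^ 2 := fun x => by
    have h1 : sInf (spectrum ℝ Q) * ‖act ((1 - α • M) ^ k) x‖ ^ 2
        ≤ Real.exp (-(r * k)) * (sSup (spectrum ℝ Q) * ‖x‖ ^ 2) :=
      calc _ ≤ normQ Q (act ((1 - α • M) ^ k) x) ^ 2 := by
            rw [normQ_sq hQ.1]; exact sInf_spectrum_mul_le hQ.1 _
        _ ≤ Real.exp (-(r * k)) * normQ Q x ^ 2 := hpow k x
        _ ≤ _ := by
            rw [normQ_sq hQ.1]; gcongr; exact le_sSup_spectrum_mul hQ.1 x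
    rw [condNumber, mul_assoc, mul_assoc, inv_mul_eq_div, le_div_iff₀ hmin]
    linarith
  set w := act ((1 - α • M) ^ k).transpose u with hw
  -- Transfers the bound from a matrix `N` to `Nᵀ`: with `w = Nᵀu`, `‖w‖² = ⟨u, Nw⟩ ≤ ‖u‖ ‖Nw‖`.
  have hself : ‖w‖ ^ 2 ≤ ‖u‖ * ‖act ((1 - α • M) ^ k) w‖ := by
    rw [← real_inner_self_eq_norm_sq]
    nth_rewrite 1 [hw]
    rw [inner_act_transpose]
    exact real_inner_le_norm _ _
  rcases (norm_nonneg w).eq_or_lt with h0 | hpos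
  · rw [← h0, zero_pow two_ne_zero]
    have := condNumber_pos hQ.1
    positivity
  · have h2 : (‖w‖ ^ 2) ^ 2 ≤ ‖u‖ ^ 2 * (condNumber Q * Real.exp (-(r * k)) * ‖w‖ ^ 2) :=
      calc (‖w‖ ^ 2) ^ 2 ≤ (‖u‖ * ‖act ((1 - α • M) ^ k) w‖) ^ 2 := by gcongr
        _ = ‖u‖ ^ 2 * ‖act ((1 - α • M) ^ k) w‖ ^ 2 := by ring
        _ ≤ _ := by gcongr; exact hbd w
    have hp2 : 0 < ‖w‖ ^ 2 := by positivity
    refine le_of_mul_le_mul_right ?_ hp2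
    linarith

end LinearAlgebra

end LSA

namespace LSA

/-! ### Existence of a positive definite Lyapunov solution. -/

section Lyapunov

variable {d : ℕ}

lemma IsNegHurwitz.re_pos {M : Mat d} (hM : IsNegHurwitz M) {z : ℂ} {v : Fin d → ℂ} (hv : v ≠ 0)
    (h : (M.map (algebraMap ℝ ℂ)).mulVec v = z • v) : 0 < z.re :=
  hM z (Module.End.hasEigenvalue_of_hasEigenvector (x := v)
    ⟨Module.End.mem_eigenspace_iff.2 (by simpa using h), hv⟩)

/-- Since `-1` is not an eigenvalue, the Cayley transform `(M - 1)(M + 1)⁻¹` is well defined. -/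
lemma IsNegHurwitz.isUnit_det_add_one {M : Mat d} (hM : IsNegHurwitz M) :
    IsUnit (M + 1).det := by
  rw [isUnit_iff_ne_zero]
  intro h0
  have h0' : ((M + 1).map (algebraMap ℝ ℂ)).det = 0 := by
    rw [← RingHom.mapMatrix_apply, ← RingHom.map_det, h0, map_zero]
  obtain ⟨v, hv, hv0⟩ := Matrix.exists_mulVec_eq_zero_iff.2 h0'
  rw [← RingHom.mapMatrix_apply, map_add, map_one, RingHom.mapMatrix_apply, Matrix.add_mulVec,
    Matrix.one_mulVec] at hv0
  have := hM.re_pos (z := -1) hv (by rw [neg_one_smul]; exact eq_neg_of_add_eq_zero_left hv0)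
  norm_num at this

/-- The Cayley transform maps the open right half plane into the open unit disc. -/
lemma norm_lt_one_of_cayley {w : ℂ} (hw : w ≠ 1) (h : 0 < ((1 + w) / (1 - w)).re) : ‖w‖ < 1 := by
  have h1 : 0 < Complex.normSq (1 - w) := Complex.normSq_pos.2 (sub_ne_zero.2 hw.symm)
  -- The real part of `(1 + w)/(1 - w)` is `(1 - |w|²)/|1 - w|²`.
  rw [Complex.div_re, ← add_div, lt_div_iff₀ h1, zero_mul] at h
  simp at h
  have h2 : Complex.normSq w < 1 := by
    rw [Complex.normSq_apply]
    linarith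
  rw [Complex.normSq_eq_norm_sq] at h2
  nlinarith [norm_nonneg w]

/-- An eigenvector `x = (M + 1)y` of the Cayley transform for `w` satisfies `(1 - w) M y = (1 + w)
y`, so `(1 + w)/(1 - w)` is an eigenvalue of `M` and has positive real part. -/
lemma IsNegHurwitz.norm_lt_one_of_mem_spectrum {M : Mat d} (hM : IsNegHurwitz M) {w : ℂ}
    (hw : w ∈ spectrum ℂ (((M - 1) * (M + 1)⁻¹).map (algebraMap ℝ ℂ))) : ‖w‖ < 1 := by
  rw [← Matrix.spectrum_toLin', ← Module.End.hasEigenvalue_iff_mem_spectrum] at hw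
  obtain ⟨x, hx⟩ := hw.exists_hasEigenvector
  have hx0 : x ≠ 0 := hx.2
  have hxw : (((M - 1) * (M + 1)⁻¹).map (algebraMap ℝ ℂ)).mulVec x = w • x := by
    simpa using hx.apply_eq_smul
  set Mc := M.map (algebraMap ℝ ℂ) with hMc
  set y := ((M + 1)⁻¹.map (algebraMap ℝ ℂ)).mulVec x with hy
  have hxy : x = Mc.mulVec y + y := by
    have h1 : (Mc + 1) * ((M + 1)⁻¹.map (algebraMap ℝ ℂ)) = 1 := by
      have := congrArg (algebraMap ℝ ℂ).mapMatrix (Matrix.mul_nonsing_inv _ hM.isUnit_det_add_one)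
      simpa only [map_mul, map_add, map_one, RingHom.mapMatrix_apply] using this
    have h2 := congrArg (fun N => Matrix.mulVec N x) h1
    simp only [Matrix.one_mulVec, ← Matrix.mulVec_mulVec, Matrix.add_mulVec] at h2
    exact h2.symm
  have hwy : Mc.mulVec y - y = w • (Mc.mulVec y + y) := by
    rw [← hxy, ← hxw, ← RingHom.mapMatrix_apply, map_mul, map_sub, map_one,
      RingHom.mapMatrix_apply, RingHom.mapMatrix_apply, ← Matrix.mulVec_mulVec, Matrix.sub_mulVec,
      Matrix.one_mulVec]
  have hy0 : y ≠ 0 := fun h => hx0 (by rw [hxy, h]; simp)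
  have hw1 : w ≠ 1 := by
    rintro rfl
    apply hy0
    rw [one_smul, sub_eq_add_neg, add_right_inj, neg_eq_self] at hwy
    exact hwy
  refine norm_lt_one_of_cayley hw1 (hM.re_pos hy0 ?_)
  have h1w : (1 - w) ≠ 0 := sub_ne_zero.2 hw1.symm
  have h3 : (1 - w) • Mc.mulVec y = (1 + w) • y := by
    rw [← sub_eq_zero] at hwy ⊢
    rw [← hwy]
    module
  rw [div_eq_inv_mul, mul_smul, ← h3, smul_smul, inv_mul_cancel₀ h1w, one_smul]

open scoped Matrix.Norms.Frobenius in
-- Gelfand's formula is applied to the complexification. The Frobenius norm is submultiplicative and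
-- unchanged by the embedding of `ℝ` in `ℂ`, so the estimate descends to `C`.
lemma exists_norm_pow_le_of_spectrum {C : Mat d}
    (hC : ∀ w ∈ spectrum ℂ (C.map (algebraMap ℝ ℂ)), ‖w‖ < 1) :
    ∃ r : ℝ, 0 ≤ r ∧ r < 1 ∧ ∀ᶠ k : ℕ in Filter.atTop, ‖C ^ k‖ ≤ r ^ k := by
  set Cc := C.map (algebraMap ℝ ℂ) with hCc
  have hrad : spectralRadius ℂ Cc < 1 := by
    rcases (spectrum ℂ Cc).eq_empty_or_nonempty with he | hne
    · simp [spectralRadius, he]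
    · exact_mod_cast spectrum.spectralRadius_lt_of_forall_lt_of_nonempty hne (r := 1)
        fun w hw => by exact_mod_cast hC w hw
  obtain ⟨r, hr, hr1⟩ := ENNReal.lt_iff_exists_nnreal_btwn.1 hrad
  refine ⟨r, r.2, by exact_mod_cast hr1, ?_⟩
  have hg := (spectrum.pow_nnnorm_pow_one_div_tendsto_nhds_spectralRadius Cc).eventually_lt_const hr
  filter_upwards [hg, Filter.eventually_gt_atTop 0] with k hk hk0
  have h1 : (‖Cc ^ k‖₊ : ENNReal) ≤ (r : ENNReal) ^ k := by
    have := ENNReal.rpow_le_rpow hk.le (z := (k : ℝ)) (by positivity)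
    rwa [← ENNReal.rpow_mul, one_div_mul_cancel (by positivity), ENNReal.rpow_one,
      ENNReal.rpow_natCast] at this
  have h2 : ‖Cc ^ k‖ ≤ (r : ℝ) ^ k := by exact_mod_cast h1
  rwa [hCc, ← RingHom.mapMatrix_apply, ← map_pow, RingHom.mapMatrix_apply,
    Matrix.frobenius_norm_map_eq _ _ (fun a => by simp)] at h2

open scoped Matrix.Norms.Frobenius in
/-- The Stein equation `Q - Cᵀ Q C = P` for a matrix `C` with spectral radius less than one. -/
lemma exists_posDef_stein {C P : Mat d}
    (hC : ∀ w ∈ spectrum ℂ (C.map (algebraMap ℝ ℂ)), ‖w‖ < 1) (hP : P.PosDef) :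
    ∃ Q : Mat d, Q.PosDef ∧ Q = P + C.transpose * Q * C := by
  obtain ⟨r, hr0, hr1, hev⟩ := exists_norm_pow_le_of_spectrum hC
  -- The solution is the series `∑ (Cᵀ)^k P C^k`: its zeroth term is `P` and its tail is `Cᵀ Q C`.
  set S : ℕ → Mat d := fun k => C.transpose ^ k * P * C ^ k with hS
  have hsum : Summable S := by
    have hgeo : Summable fun k : ℕ => ‖P‖ * (r ^ 2) ^ k :=
      (summable_geometric_of_lt_one (by positivity) (by nlinarith)).mul_left _
    refine Summable.of_norm_bounded_eventually_nat hgeo ?_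
    filter_upwards [hev] with k hk
    calc ‖S k‖ ≤ ‖C.transpose ^ k‖ * ‖P‖ * ‖C ^ k‖ :=
          (norm_mul_le _ _).trans (by gcongr; exact norm_mul_le _ _)
      _ = ‖C ^ k‖ * ‖P‖ * ‖C ^ k‖ := by
          rw [← Matrix.transpose_pow, Matrix.frobenius_norm_transpose]
      _ ≤ r ^ k * ‖P‖ * r ^ k := by gcongr
      _ = _ := by ring
  have hstep : ∀ k, S (k + 1) = C.transpose * S k * C := fun k => by
    simp only [hS, pow_succ' C.transpose, pow_succ C, Matrix.mul_assoc]
  have heq : ∑' k, S k = P + C.transpose * (∑' k, S k) * C := by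
    calc ∑' k, S k = S 0 + ∑' k, C.transpose * S k * C := by
          rw [hsum.tsum_eq_zero_add]
          simp only [hstep]
      _ = _ := by
          rw [(hsum.mul_left _).tsum_mul_right, hsum.tsum_mul_left]
          simp [hS]
  have hpsd : ∀ k, (S k).PosSemidef := fun k => by
    have := hP.posSemidef.conjTranspose_mul_mul_same (C ^ k)
    rwa [Matrix.conjTranspose_eq_transpose_of_trivial, Matrix.transpose_pow] at this
  have hQ : (∑' k, S k).PosSemidef := by
    refine Matrix.PosSemidef.of_dotProduct_mulVec_nonneg ?_ fun x => ?_
    · rw [Matrix.IsHermitian, Matrix.conjTranspose_tsum]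
      exact tsum_congr fun k => (hpsd k).1
    · have hcont : Continuous fun N : Mat d => star x ⬝ᵥ N.mulVec x := by fun_prop
      refine ge_of_tendsto' ((hcont.tendsto _).comp hsum.hasSum) fun F => ?_
      exact (Matrix.posSemidef_sum F fun k _ => hpsd k).dotProduct_mulVec_nonneg x
  refine ⟨∑' k, S k, ?_, heq⟩
  rw [heq]
  refine hP.add_posSemidef ?_
  have := hQ.conjTranspose_mul_mul_same C
  rwa [Matrix.conjTranspose_eq_transpose_of_trivial] at this

/-- Lyapunov's theorem: if `-M` is Hurwitz, then `Mᵀ Q + Q M = I` has a positive definite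
solution. -/
theorem IsNegHurwitz.exists_isLyapunovSolution {M : Mat d} (hM : IsNegHurwitz M) :
    ∃ Q : Mat d, IsLyapunovSolution M Q := by
  set N := (M + 1)⁻¹ with hN
  have hNM : N * (M + 1) = 1 := Matrix.nonsing_inv_mul _ hM.isUnit_det_add_one
  have hMN : (M + 1) * N = 1 := Matrix.mul_nonsing_inv _ hM.isUnit_det_add_one
  -- This right-hand side becomes `2I` when the Stein equation is conjugated by `M + 1`. Then
  -- `(M+1)ᵀQ(M+1) - (M-1)ᵀQ(M-1) = 2(MᵀQ + QM)` yields the Lyapunov equation.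
  have hP : ((2 : ℝ) • (N.transpose * N)).PosDef := by
    have : (N.conjTranspose * N).PosDef := Matrix.PosDef.conjTranspose_mul_self N
      (Matrix.mulVec_injective_of_isUnit ⟨⟨N, M + 1, hNM, hMN⟩, rfl⟩)
    rw [Matrix.conjTranspose_eq_transpose_of_trivial] at this
    exact this.smul (by norm_num)
  obtain ⟨Q, hQ, hstein⟩ := exists_posDef_stein
    (fun w hw => hM.norm_lt_one_of_mem_spectrum hw) hP
  refine ⟨Q, hQ, ?_⟩
  set C := (M - 1) * N with hC
  have hCM : C * (M + 1) = M - 1 := by rw [hC, Matrix.mul_assoc, hNM, Matrix.mul_one]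
  have h1 : (M + 1).transpose * Q * (M + 1)
      = (2 : ℝ) • (1 : Mat d) + (M - 1).transpose * Q * (M - 1) := by
    calc _ = (M + 1).transpose * ((2 : ℝ) • (N.transpose * N) + C.transpose * Q * C) * (M + 1) := by
          rw [← hstein]
      _ = (2 : ℝ) • ((N * (M + 1)).transpose * (N * (M + 1)))
          + (C * (M + 1)).transpose * Q * (C * (M + 1)) := by
          generalize M + 1 = E
          simp only [Matrix.transpose_mul, Matrix.mul_add, Matrix.add_mul, Matrix.mul_assoc,
            Matrix.mul_smul, Matrix.smul_mul]
      _ = _ := by rw [hNM, hCM, Matrix.transpose_one, Matrix.one_mul]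
  have h2 : (2 : ℝ) • (M.transpose * Q + Q * M) = (2 : ℝ) • (1 : Mat d) := by
    rw [← sub_eq_iff_eq_add] at h1
    rw [← h1]
    simp only [Matrix.transpose_add, Matrix.transpose_sub, Matrix.transpose_one, two_smul]
    noncomm_ring
  exact smul_right_injective _ (two_ne_zero' ℝ) h2

lemma IsNegHurwitz.isLyapunovSolution_lyapunovQ {M : Mat d} (hM : IsNegHurwitz M) :
    IsLyapunovSolution M (lyapunovQ M) := by
  rw [lyapunovQ, dif_pos hM.exists_isLyapunovSolution]
  exact hM.exists_isLyapunovSolution.choose_spec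

end Lyapunov

end LSA

/-! ### Sub-Gaussian bounds for the noise. -/

namespace LSA

lemma _root_.ProbabilityTheory.HasSubgaussianMGF.mono {Ω : Type*} [MeasurableSpace Ω]
    {μ : Measure Ω} {X : Ω → ℝ} {c c' : NNReal} (h : HasSubgaussianMGF X c μ) (hc : c ≤ c') :
    HasSubgaussianMGF X c' μ where
  integrable_exp_mul := h.integrable_exp_mul
  mgf_le t := (h.mgf_le t).trans (by gcongr)

variable {d : ℕ}

lemma inner_act_eq_sum (M : Mat d) (v x : Vec d) :
    inner ℝ v (act M x) = ∑ i, ∑ j, v i * x j * M i j := by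
  simp only [act, PiLp.inner_apply, Matrix.ofLp_toEuclideanCLM, Matrix.mulVec, dotProduct,
    RCLike.inner_apply, conj_trivial, Finset.sum_mul]
  exact Finset.sum_congr rfl fun i _ => Finset.sum_congr rfl fun j _ => by ring

lemma abs_apply_le_specNorm (M : Mat d) (i j : Fin d) : |M i j| ≤ specNorm M := by
  have h : M i j = inner ℝ (EuclideanSpace.single i (1 : ℝ))
      (act M (EuclideanSpace.single j (1 : ℝ))) := by
    simp [act, Matrix.ofLp_toEuclideanCLM, EuclideanSpace.inner_single_left]
  rw [h]
  refine (abs_real_inner_le_norm _ _).trans ?_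
  simpa using norm_act_le M (EuclideanSpace.single j (1 : ℝ))

lemma measurable_apply_apply (i j : Fin d) : Measurable fun M : Mat d => M i j :=
  (measurable_pi_apply (X := fun _ : Fin d => ℝ) j).comp
    (measurable_pi_apply (X := fun _ : Fin d => Fin d → ℝ) i)

lemma measurable_inner_act (v x : Vec d) : Measurable fun M : Mat d => inner ℝ v (act M x) := by
  simp only [inner_act_eq_sum]
  exact Finset.measurable_sum _ fun i _ => Finset.measurable_sum _ fun j _ =>
    (measurable_apply_apply i j).const_mul _

section Noise

variable {Ω : Type*} [MeasurableSpace Ω] {μ : Measure Ω}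
  {A : ℕ+ → Ω → Mat d} {b : ℕ+ → Ω → Vec d} {CA Cb : ℝ}

lemma Ceps_sq : Ceps μ A b CA Cb ^ 2 = 2 * Cb ^ 2 + 8 * CA ^ 2 * ‖thetaStar μ A b‖ ^ 2 :=
  Real.sq_sqrt (by positivity)

lemma Assumption.Ceps_pos (h : Assumption μ A b CA Cb) : 0 < Ceps μ A b CA Cb := by
  have := h.Cb_pos
  exact Real.sqrt_pos.2 (by positivity)

lemma measurable_inner_noise (v : Vec d) :
    Measurable fun p : Mat d × Vec d =>
      inner ℝ v (p.2 - meanB μ b - act (p.1 - meanA μ A) (thetaStar μ A b)) := by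
  simp only [inner_sub_right, act_sub]
  have h1 : Measurable fun p : Mat d × Vec d => inner ℝ v p.2 :=
    (continuous_const.inner continuous_id).measurable.comp measurable_snd
  exact (h1.sub_const _).sub
    (((measurable_inner_act v _).comp measurable_fst).sub_const _)

lemma Assumption.identDistrib_inner_noise (h : Assumption μ A b CA Cb) (v : Vec d) (n : ℕ+) :
    IdentDistrib (fun ω => inner ℝ v (noise μ A b n ω)) (fun ω => inner ℝ v (noise μ A b 1 ω))
      μ μ :=
  (h.identDistrib n).comp (measurable_inner_noise v)

variable [IsProbabilityMeasure μ]

lemma Assumption.inner_subgaussian (h : Assumption μ A b CA Cb) (v : Vec d) :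
    HasSubgaussianMGF (fun ω => inner ℝ v (b 1 ω - meanB μ b))
      (Real.toNNReal (‖v‖ ^ 2 * Cb ^ 2)) μ := by
  rcases eq_or_ne v 0 with rfl | hv
  · simp
  have hv' := norm_pos_iff.2 hv
  have h1 := (h.subgaussian (‖v‖⁻¹ • v) (by
    rw [norm_smul, norm_inv, norm_norm, inv_mul_cancel₀ hv'.ne'])).const_mul ‖v‖
  convert! h1 using 1
  · ext ω
    rw [real_inner_smul_left, mul_inv_cancel_left₀ hv'.ne']
  · rw [Real.toNNReal_mul (sq_nonneg _)]
    congr 1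
    exact Real.toNNReal_of_nonneg _

lemma Assumption.integrable_b (h : Assumption μ A b CA Cb) : Integrable (b 1) μ := by
  have hcoord : ∀ i, Integrable (fun ω => b 1 ω i) μ := fun i => by
    have h1 := (h.inner_subgaussian (EuclideanSpace.single i (1 : ℝ))).integrable
    have h2 := h1.add (integrable_const (meanB μ b i))
    refine h2.congr (ae_of_all _ fun ω => ?_)
    simp [EuclideanSpace.inner_single_left]
  exact Integrable.of_eval_piLp hcoord

lemma Assumption.integral_inner_b (h : Assumption μ A b CA Cb) (v : Vec d) :
    ∫ ω, inner ℝ v (b 1 ω - meanB μ b) ∂μ = 0 := by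
  have hi : Integrable (fun ω => b 1 ω - meanB μ b) μ := h.integrable_b.sub (integrable_const _)
  rw [integral_inner hi, integral_sub h.integrable_b (integrable_const _)]
  simp [meanB]

lemma Assumption.integrable_A (h : Assumption μ A b CA Cb) (i j : Fin d) :
    Integrable (fun ω => A 1 ω i j) μ := by
  refine Integrable.of_bound ((measurable_apply_apply i j).comp
    (h.measurable_A 1)).aestronglyMeasurable CA ?_
  filter_upwards [h.bounded] with ω hω
  exact (abs_apply_le_specNorm _ i j).trans hω

lemma Assumption.integral_inner_act_A (h : Assumption μ A b CA Cb) (v x : Vec d) :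
    ∫ ω, inner ℝ v (act (A 1 ω) x) ∂μ = inner ℝ v (act (meanA μ A) x) := by
  simp only [inner_act_eq_sum]
  rw [integral_finsetSum _ fun i _ => integrable_finsetSum _ fun j _ =>
    (h.integrable_A i j).const_mul _]
  refine Finset.sum_congr rfl fun i _ => ?_
  rw [integral_finsetSum _ fun j _ => (h.integrable_A i j).const_mul _]
  refine Finset.sum_congr rfl fun j _ => ?_
  rw [integral_const_mul]
  rfl

/-- Hoeffding's lemma on `[-B, B]`, an interval of half-width `B = ‖v‖ C_A ‖x‖`, gives the proxy
`B²`. -/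
lemma Assumption.inner_act_subgaussian (h : Assumption μ A b CA Cb) (v x : Vec d) :
    HasSubgaussianMGF (fun ω => inner ℝ v (act (A 1 ω - meanA μ A) x))
      (Real.toNNReal (‖v‖ ^ 2 * (CA * ‖x‖) ^ 2)) μ := by
  set B := ‖v‖ * (CA * ‖x‖) with hB
  have hB0 : 0 ≤ B := by have := h.CA_pos; positivity
  have hbd : ∀ᵐ ω ∂μ, inner ℝ v (act (A 1 ω) x) ∈ Set.Icc (-B) B := by
    filter_upwards [h.bounded] with ω hω
    rw [Set.mem_Icc, ← abs_le]
    refine (abs_real_inner_le_norm _ _).trans ?_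
    exact mul_le_mul_of_nonneg_left ((norm_act_le _ _).trans (by gcongr)) (norm_nonneg v)
  have h1 := hasSubgaussianMGF_of_mem_Icc (((measurable_inner_act v x).comp
    (h.measurable_A 1)).aemeasurable) hbd
  simp only [Function.comp_def, h.integral_inner_act_A] at h1
  convert! h1 using 1
  · ext ω
    rw [act_sub, inner_sub_right]
  · rw [← mul_pow, ← hB]
    ext
    rw [Real.coe_toNNReal _ (sq_nonneg B)]
    simp only [NNReal.coe_pow, NNReal.coe_div, coe_nnnorm, Real.norm_eq_abs]
    rw [sub_neg_eq_add, abs_of_nonneg (by positivity)]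
    norm_num

/-- `A_n` and `b_n` may be dependent, so the square roots of the proxies add: `(C_b + C_A‖θ*‖)² ≤
2C_b² + 2C_A²‖θ*‖² ≤ C_ε²`. -/
lemma Assumption.inner_noise_subgaussian (h : Assumption μ A b CA Cb) (v : Vec d) (n : ℕ+) :
    HasSubgaussianMGF (fun ω => inner ℝ v (noise μ A b n ω))
      (Real.toNNReal (‖v‖ ^ 2 * Ceps μ A b CA Cb ^ 2)) μ := by
  refine HasSubgaussianMGF.congr_identDistrib ?_ (h.identDistrib_inner_noise v n).symm
  have h1 := ((h.inner_subgaussian v).add (h.inner_act_subgaussian v (thetaStar μ A b)).neg).mono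
    (c' := Real.toNNReal (‖v‖ ^ 2 * Ceps μ A b CA Cb ^ 2)) (by
      rw [← NNReal.coe_le_coe, Real.coe_toNNReal _ (by positivity), Ceps_sq]
      simp only [NNReal.coe_pow, NNReal.coe_add, Real.coe_sqrt]
      rw [Real.coe_toNNReal _ (by positivity), Real.coe_toNNReal _ (by positivity),
        ← mul_pow, ← mul_pow, Real.sqrt_sq (by have := h.Cb_pos; positivity),
        Real.sqrt_sq (by have := h.CA_pos; positivity)]
      nlinarith [sq_nonneg (‖v‖ * Cb - ‖v‖ * (CA * ‖thetaStar μ A b‖)),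
        sq_nonneg (‖v‖ * (CA * ‖thetaStar μ A b‖))])
  refine h1.congr (ae_of_all _ fun ω => ?_)
  simp only [noise, Pi.neg_apply]
  rw [inner_sub_right _ (b 1 ω - meanB μ b)]
  ring

lemma Assumption.integral_inner_noise (h : Assumption μ A b CA Cb) (v : Vec d) (n : ℕ+) :
    ∫ ω, inner ℝ v (noise μ A b n ω) ∂μ = 0 := by
  rw [(h.identDistrib_inner_noise v n).integral_eq]
  have hA : Integrable (fun ω => inner ℝ v (act (A 1 ω) (thetaStar μ A b))) μ := by
    have := (h.inner_act_subgaussian v (thetaStar μ A b)).integrable.add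
      (integrable_const (inner ℝ v (act (meanA μ A) (thetaStar μ A b))))
    refine this.congr (ae_of_all _ fun ω => ?_)
    simp [act_sub, inner_sub_right]
  simp only [noise, inner_sub_right v (_ - meanB μ b)]
  rw [integral_sub (h.inner_subgaussian v).integrable
    (h.inner_act_subgaussian v _).integrable, h.integral_inner_b]
  simp only [act_sub, inner_sub_right]
  rw [integral_sub hA (integrable_const _), h.integral_inner_act_A]
  simp

end Noise

end LSA

namespace LSA

/-! ### The projected statistic as an independent sum, and its variance. -/

section LinearStatistic

variable {d : ℕ} {Ω : Type*} [MeasurableSpace Ω] {μ : Measure Ω}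
  {A : ℕ+ → Ω → Mat d} {b : ℕ+ → Ω → Vec d} {CA Cb : ℝ}

lemma inner_J (α : ℝ) (n : ℕ+) (u : Vec d) (ω : Ω) :
    inner ℝ u (J μ A b α n ω) = ∑ j ∈ Finset.Icc 1 n,
      inner ℝ (α • act (G μ A α (j + 1) n).transpose u) (noise μ A b j ω) := by
  simp only [J, real_inner_smul_right, inner_sum, real_inner_smul_left, Finset.mul_sum,
    inner_act_transpose]

lemma Assumption.iIndepFun_inner_noise (h : Assumption μ A b CA Cb) (v : ℕ+ → Vec d) :
    iIndepFun (fun n ω => inner ℝ (v n) (noise μ A b n ω)) μ :=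
  h.indep.comp (fun n p => inner ℝ (v n) (p.2 - meanB μ b - act (p.1 - meanA μ A)
    (thetaStar μ A b))) fun n => measurable_inner_noise (v n)

variable [IsProbabilityMeasure μ]

lemma Assumption.memLp_inner_noise (h : Assumption μ A b CA Cb) (v : Vec d) (n : ℕ+) :
    MemLp (fun ω => inner ℝ v (noise μ A b n ω)) 2 μ :=
  (h.inner_noise_subgaussian v n).memLp 2

lemma Assumption.memLp_inner_J (h : Assumption μ A b CA Cb) (α : ℝ) (n : ℕ+) (u : Vec d) :
    MemLp (fun ω => inner ℝ u (J μ A b α n ω)) 2 μ := by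
  simp only [inner_J]
  exact memLp_finsetSum _ fun j _ => h.memLp_inner_noise _ j

lemma Assumption.inner_act_covJ (h : Assumption μ A b CA Cb) (α : ℝ) (n : ℕ+) (u : Vec d) :
    inner ℝ u (act (covJ μ A b α n) u) = Var[fun ω => inner ℝ u (J μ A b α n ω); μ] := by
  have hc : ∀ i, MemLp (fun ω => J μ A b α n ω i) 2 μ := fun i => by
    simpa [EuclideanSpace.inner_single_left] using
      h.memLp_inner_J α n (EuclideanSpace.single i (1 : ℝ))
  rw [inner_act_eq_sum, ← covariance_self (h.memLp_inner_J α n u).aemeasurable]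
  have hsum : (fun ω => inner ℝ u (J μ A b α n ω)) = fun ω => ∑ i, u i * J μ A b α n ω i := by
    ext ω
    simp [PiLp.inner_apply, mul_comm]
  rw [hsum, covariance_fun_sum_fun_sum (fun i => (hc i).const_mul _)
    (fun i => (hc i).const_mul _)]
  refine Finset.sum_congr rfl fun i _ => Finset.sum_congr rfl fun k _ => ?_
  rw [covariance_const_mul_left, covariance_const_mul_right, covJ, Matrix.of_apply]
  ring

lemma Assumption.sum_integral_sq (h : Assumption μ A b CA Cb) (α : ℝ) (n : ℕ+) (u : Vec d) :
    ∑ j ∈ Finset.Icc 1 n, ∫ ω, (inner ℝ (α • act (G μ A α (j + 1) n).transpose u)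
      (noise μ A b j ω)) ^ 2 ∂μ = inner ℝ u (act (covJ μ A b α n) u) := by
  set v : ℕ+ → Vec d := fun j => α • act (G μ A α (j + 1) n).transpose u with hv
  have hsum : (fun ω => inner ℝ u (J μ A b α n ω))
      = ∑ j ∈ Finset.Icc 1 n, fun ω => inner ℝ (v j) (noise μ A b j ω) := by
    ext ω
    rw [inner_J, Finset.sum_apply]
  rw [h.inner_act_covJ, hsum, IndepFun.variance_sum (fun j _ => h.memLp_inner_noise _ j)
    fun i _ j _ hij => (h.iIndepFun_inner_noise v).indepFun hij]
  refine Finset.sum_congr rfl fun j _ => ?_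
  rw [variance_of_integral_eq_zero (h.memLp_inner_noise _ j).aemeasurable
    (h.integral_inner_noise _ j)]

end LinearStatistic

/-! ### Scalar estimates. -/

section Scalar

lemma sum_Icc_exp_neg_mul_le {r : ℝ} (hr : 0 < r) (hr1 : r ≤ 1) (n : ℕ+) :
    ∑ j ∈ Finset.Icc 1 n, Real.exp (-(r * ((n : ℕ) - (j : ℕ) : ℕ))) ≤ 2 / r := by
  -- `e^{-r} ≤ 1/(1 + r)`, and `(1 + r)(1 - r/2) ≥ 1` when `0 ≤ r ≤ 1`.
  have hq : Real.exp (-r) ≤ 1 - r / 2 := by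
    rw [Real.exp_neg, inv_le_iff_one_le_mul₀ (Real.exp_pos r)]
    nlinarith [Real.add_one_le_exp r]
  have hq1 : Real.exp (-r) < 1 := by linarith
  have hpow : ∀ k : ℕ, Real.exp (-(r * k)) = Real.exp (-r) ^ k := fun k => by
    rw [← Real.exp_nat_mul]; ring_nf
  have hinj : Set.InjOn (fun j : ℕ+ => (n : ℕ) - (j : ℕ)) (Finset.Icc 1 n : Finset ℕ+) := by
    intro i hi j hj hij
    simp only [Finset.coe_Icc, Set.mem_Icc, ← PNat.coe_le_coe] at hi hj
    apply PNat.coe_injective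
    dsimp only at hij
    omega
  calc ∑ j ∈ Finset.Icc 1 n, Real.exp (-(r * ((n : ℕ) - (j : ℕ) : ℕ)))
      = ∑ j ∈ Finset.Icc 1 n, Real.exp (-r) ^ ((n : ℕ) - (j : ℕ)) :=
        Finset.sum_congr rfl fun j _ => hpow _
    _ = ∑ k ∈ (Finset.Icc 1 n).image (fun j : ℕ+ => (n : ℕ) - (j : ℕ)), Real.exp (-r) ^ k :=
        (Finset.sum_image (f := fun k => Real.exp (-r) ^ k) hinj).symm
    _ ≤ ∑' k : ℕ, Real.exp (-r) ^ k :=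
        (summable_geometric_of_lt_one (Real.exp_pos _).le hq1).sum_le_tsum _
          fun k _ => by positivity
    _ = (1 - Real.exp (-r))⁻¹ := tsum_geometric_of_lt_one (Real.exp_pos _).le hq1
    _ ≤ (r / 2)⁻¹ := by gcongr; linarith
    _ = 2 / r := inv_div r 2

lemma log_two_le_log_two_div {δ : ℝ} (hδ : 0 < δ) (hδ1 : δ < 1) :
    Real.log 2 ≤ Real.log (2 / δ) := by
  apply Real.log_le_log (by norm_num)
  rw [le_div_iff₀ hδ]
  linarith

/-- The constants 8 and 24 come from `4·2` and `4·2·3`. Because `L > 0.69`, one has `2t ≤ 2l + 6L ≤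
9(1 + l)L`, which lets the additive `l` enter as a factor. -/
lemma threshold_le {L l s t c V E₁ E₂ : ℝ} (hL : Real.log 2 ≤ L) (hl : 0 ≤ l)
    (hs : s ≤ 2 * L) (ht : t ≤ l + 3 * L) (hc : 0 ≤ c) (hV : 0 ≤ V)
    (hE₁ : 8 ≤ E₁) (hE₂ : 24 ≤ E₂) :
    4 * Real.sqrt (s * V) + 4 * s * (c * Real.sqrt (2 * t)) ≤
      E₁ * Real.sqrt (V * L) + E₂ * c * Real.sqrt (1 + l) * L ^ (3 / 2 : ℝ) := by
  have hL0 : 0 < L := (Real.log_pos (by norm_num)).trans_le hL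
  have hL2 : 0.69 < L := by linarith [Real.log_two_gt_d9]
  have h1 : Real.sqrt (s * V) ≤ 2 * Real.sqrt (V * L) := by
    rw [show (2 : ℝ) = Real.sqrt 4 by norm_num [show (4 : ℝ) = 2 ^ 2 by norm_num],
      ← Real.sqrt_mul (by norm_num)]
    apply Real.sqrt_le_sqrt
    nlinarith [mul_le_mul_of_nonneg_right hs hV, mul_nonneg hV hL0.le]
  have h2 : Real.sqrt (2 * t) ≤ 3 * (Real.sqrt (1 + l) * Real.sqrt L) := by
    rw [show (3 : ℝ) = Real.sqrt 9 by norm_num [show (9 : ℝ) = 3 ^ 2 by norm_num],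
      ← Real.sqrt_mul (by positivity), ← Real.sqrt_mul (by norm_num)]
    apply Real.sqrt_le_sqrt
    nlinarith [mul_nonneg hl hL0.le, mul_le_mul_of_nonneg_left hL2.le hl]
  have h3 : L ^ (3 / 2 : ℝ) = L * Real.sqrt L := by
    rw [show (3 / 2 : ℝ) = 1 + 1 / 2 by norm_num, Real.rpow_add hL0, Real.rpow_one,
      Real.sqrt_eq_rpow]
  have h4 : 4 * s * (c * Real.sqrt (2 * t))
      ≤ 4 * (2 * L) * (c * (3 * (Real.sqrt (1 + l) * Real.sqrt L))) := by gcongr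
  have h5 : 24 * (c * Real.sqrt (1 + l) * (L * Real.sqrt L))
      ≤ E₂ * (c * Real.sqrt (1 + l) * (L * Real.sqrt L)) := by gcongr
  have h6 : 8 * Real.sqrt (V * L) ≤ E₁ * Real.sqrt (V * L) := by gcongr
  rw [h3]
  linarith

end Scalar

/-! ### Tails of the individual terms. -/

section Tail

variable {d : ℕ} {Ω : Type*} [MeasurableSpace Ω] {μ : Measure Ω} [IsProbabilityMeasure μ]
  {A : ℕ+ → Ω → Mat d} {b : ℕ+ → Ω → Vec d} {CA Cb : ℝ}

lemma measureReal_abs_ge_le_of_hasSubgaussianMGF {X : Ω → ℝ} {c : NNReal} {M : ℝ}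
    (hX : HasSubgaussianMGF X c μ) (hM : 0 ≤ M) :
    μ.real {ω | M ≤ |X ω|} ≤ 2 * Real.exp (-M ^ 2 / (2 * c)) := by
  have hsub : {ω | M ≤ |X ω|} ⊆ {ω | M ≤ X ω} ∪ {ω | M ≤ (-X) ω} := fun ω hω =>
    le_abs.1 (show M ≤ |X ω| from hω)
  rw [two_mul]
  exact ((measureReal_mono hsub).trans (measureReal_union_le _ _)).trans
    (add_le_add (hX.measure_ge_le hM) (hX.neg.measure_ge_le hM))

/-- A proxy smaller by `e^{-x}` turns the exponent into `t e^x`, and `t e^x ≥ t + x` for `t ≥ 1`.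
Hence one truncation level serves every index and the tails remain summable. -/
lemma Assumption.measureReal_abs_inner_noise_ge_le (h : Assumption μ A b CA Cb) {v : Vec d}
    {c t x : ℝ} (hc : 0 < c) (ht : 1 ≤ t) (hx : 0 ≤ x)
    (hv : ‖v‖ ^ 2 * Ceps μ A b CA Cb ^ 2 ≤ c ^ 2 * Real.exp (-x)) (j : ℕ+) :
    μ.real {ω | c * Real.sqrt (2 * t) ≤ |inner ℝ v (noise μ A b j ω)|}
      ≤ 2 * Real.exp (-t) * Real.exp (-x) := by
  have hp : 0 < c ^ 2 * Real.exp (-x) := by positivity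
  have hsg := (h.inner_noise_subgaussian v j).mono (Real.toNNReal_le_toNNReal hv)
  refine (measureReal_abs_ge_le_of_hasSubgaussianMGF hsg (by positivity)).trans ?_
  rw [Real.coe_toNNReal _ hp.le, mul_assoc, ← Real.exp_add, mul_pow, Real.sq_sqrt (by positivity)]
  have : -(c ^ 2 * (2 * t)) / (2 * (c ^ 2 * Real.exp (-x))) = -(t * Real.exp x) := by
    rw [Real.exp_neg]
    field_simp
  rw [this]
  gcongr
  nlinarith [Real.add_one_le_exp x]

end Tail

end LSA

/-! ### Choice of parameters and conclusion. -/

open LSA in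
theorem mainTheorem9 {d : ℕ} {Ω : Type*} [MeasurableSpace Ω]
    (μ : MeasureTheory.Measure Ω) [MeasureTheory.IsProbabilityMeasure μ]
    (A : ℕ+ → Ω → LSA.Mat d) (b : ℕ+ → Ω → LSA.Vec d) (CA Cb : ℝ)
    (hA1 : LSA.Assumption μ A b CA Cb)
    (n : ℕ+) (α : ℝ) (hα_pos : 0 < α) (hα_le : α ≤ LSA.alphaInf (LSA.meanA μ A))
    (u : LSA.Vec d) (hu : ‖u‖ = 1) (δ : ℝ) (hδ_pos : 0 < δ) (hδ_lt : δ < 1) :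
    1 - δ ≤ μ.real {ω : Ω |
      |inner ℝ u (LSA.J μ A b α n ω)| <
        LSA.D1 * Real.sqrt (inner ℝ u (LSA.act (LSA.covJ μ A b α n) u) * Real.log (2 / δ)) +
        α * Real.sqrt (1 + Real.log (1 / (LSA.rateA (LSA.meanA μ A) * α))) *
          LSA.D2 μ A b CA Cb * Real.log (2 / δ) ^ (3 / 2 : ℝ)} := by
  have hne : Nonempty (Fin d) := by
    by_contra hempty
    rw [not_nonempty_iff] at hempty
    rw [Subsingleton.elim u 0, norm_zero] at hu
    exact zero_ne_one hu
  set Q := lyapunovQ (meanA μ A) with hQdef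
  -- As `0⁻¹ = 0`, the existence of `0 < α ≤ α_∞` rules out vanishing norms.
  have hαinf : 0 < (opNormQ Q (meanA μ A) ^ 2)⁻¹ * (specNorm Q)⁻¹ := by
    have := hα_pos.trans_le hα_le
    rw [alphaInf] at this
    linarith
  have hQ : IsLyapunovSolution (meanA μ A) Q := hA1.hurwitz.isLyapunovSolution_lyapunovQ
  have hop : 0 < opNormQ Q (meanA μ A) ^ 2 := by
    refine (sq_nonneg _).lt_of_ne fun h0 => ?_
    rw [← h0] at hαinf
    simp at hαinf
  have hspec : 0 < (specNorm Q)⁻¹ := pos_of_mul_pos_right hαinf (inv_pos.2 hop).le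
  have hle : α * opNormQ Q (meanA μ A) ^ 2 ≤ (specNorm Q)⁻¹ / 2 := by
    rw [← le_div_iff₀ hop]
    refine hα_le.trans_eq ?_
    rw [alphaInf]
    ring
  set r := rateA (meanA μ A) * α with hrdef
  have hr' : r = (specNorm Q)⁻¹ / 2 * α := rfl
  have hr : 0 < r := by rw [hr']; positivity
  have hr1 : r ≤ 1 := rate_mul_le_one hQ hα_pos.le hle
  have hκ := condNumber_pos hQ.1
  have hC := hA1.Ceps_pos
  set c := α * Real.sqrt (condNumber Q) * Ceps μ A b CA Cb with hcdef
  have hc : 0 < c := by positivity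
  set L := Real.log (2 / δ) with hLdef
  have hL : Real.log 2 ≤ L := log_two_le_log_two_div hδ_pos hδ_lt
  have hlog2 := Real.log_two_gt_d9
  set l := Real.log (1 / r) with hldef
  have hl : 0 ≤ l := Real.log_nonneg (by rw [le_div_iff₀ hr]; linarith)
  -- Chosen so that `e^{-t} = rδ/8` and `e^{-s} = δ/4`: the tails sum to at most `2e^{-t}·(2/r) =
  -- δ/2`, and the two sides of Bernstein's bound add `2·δ/4`.
  set t := l + L + 2 * Real.log 2 with htdef
  set s := L + Real.log 2 with hsdef
  have hexps : Real.exp (-s) = δ / 4 := by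
    rw [hsdef, hLdef, ← Real.log_mul (by positivity) (by norm_num), Real.exp_neg,
      Real.exp_log (by positivity)]
    field_simp
    norm_num
  have hexpt : Real.exp (-t) = r * δ / 8 := by
    rw [htdef, hldef, hLdef, two_mul, ← Real.log_mul (by positivity) (by positivity),
      ← Real.log_mul (by norm_num) (by norm_num),
      ← Real.log_mul (by positivity) (by norm_num), Real.exp_neg, Real.exp_log (by positivity)]
    field_simp
    norm_num
  have ht1 : 1 ≤ t := by linarith
  set v : ℕ+ → Vec d := fun j => α • act (G μ A α (j + 1) n).transpose u with hv
  have hvle : ∀ j ∈ Finset.Icc 1 n, ‖v j‖ ^ 2 * Ceps μ A b CA Cb ^ 2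
      ≤ c ^ 2 * Real.exp (-(r * ((n : ℕ) - (j : ℕ) : ℕ))) := fun j _ => by
    have h1 := norm_act_pow_transpose_sq_le hQ hα_pos.le hle ((n : ℕ) - (j : ℕ)) u
    rw [hu, one_pow, mul_one, ← hr'] at h1
    have h2 : G μ A α (j + 1) n = (1 - α • meanA μ A) ^ ((n : ℕ) - (j : ℕ)) := by
      rw [G, PNat.add_coe, PNat.one_coe, Nat.add_sub_add_right]
    rw [hv, hcdef]
    dsimp only
    rw [h2, norm_smul, mul_pow, mul_pow, mul_pow, Real.sq_sqrt hκ.le, Real.norm_eq_abs, sq_abs]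
    calc _ ≤ α ^ 2 * (condNumber Q * Real.exp (-(r * ((n : ℕ) - (j : ℕ) : ℕ))))
          * Ceps μ A b CA Cb ^ 2 := by gcongr
      _ = _ := by ring
  have htail : ∑ j ∈ Finset.Icc 1 n,
      μ.real {ω | c * Real.sqrt (2 * t) ≤ |inner ℝ (v j) (noise μ A b j ω)|} ≤ δ / 2 := by
    calc _ ≤ ∑ j ∈ Finset.Icc 1 n,
          2 * Real.exp (-t) * Real.exp (-(r * ((n : ℕ) - (j : ℕ) : ℕ))) :=
          Finset.sum_le_sum fun j hj => hA1.measureReal_abs_inner_noise_ge_le hc ht1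
            (by positivity) (hvle j hj) j
      _ ≤ 2 * Real.exp (-t) * (2 / r) := by
          rw [← Finset.mul_sum]
          gcongr
          exact sum_Icc_exp_neg_mul_le hr hr1 n
      _ = δ / 2 := by
          rw [hexpt]
          field_simp
          norm_num
  set V := inner ℝ u (act (covJ μ A b α n) u) with hVdef
  have hVeq := hA1.sum_integral_sq α n u
  have hV : 0 ≤ V := by
    rw [hVdef, hA1.inner_act_covJ]
    exact variance_nonneg _ _
  have hbern := measureReal_abs_sum_ge_le (S := Finset.Icc 1 n) (s := s) (V := V)
    (hA1.iIndepFun_inner_noise v) (fun j => hA1.memLp_inner_noise _ j)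
    (fun j => hA1.integral_inner_noise _ j) (by positivity) (by linarith) hVeq htail (by linarith)
  rw [hexps] at hbern
  have hsqrt3 : 1 ≤ Real.sqrt 3 := Real.one_le_sqrt.2 (by norm_num)
  have hE₁ : 8 ≤ D1 := by
    have h1 : 1 ≤ Real.exp (4 / 3) := Real.one_le_exp (by norm_num)
    rw [D1]
    nlinarith
  have hE₂ : 24 ≤ 540 * Real.sqrt 3 * Real.exp (1 / 3) := by
    have h1 : 1 ≤ Real.exp (1 / 3) := Real.one_le_exp (by norm_num)
    nlinarith
  have hthr := threshold_le (s := s) (t := t) (V := V) hL hl (by linarith) (by linarith)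
    hc.le hV hE₁ hE₂
  set T := D1 * Real.sqrt (V * L) + α * Real.sqrt (1 + l) * D2 μ A b CA Cb * L ^ (3 / 2 : ℝ)
    with hTdef
  have hT : 4 * Real.sqrt (s * V) + 4 * s * (c * Real.sqrt (2 * t)) ≤ T := by
    refine hthr.trans_eq ?_
    rw [hTdef, D2, hcdef]
    ring
  have hbad : μ.real {ω | T ≤ |inner ℝ u (J μ A b α n ω)|} ≤ δ := by
    calc _ ≤ δ / 2 + 2 * (δ / 4) := by
          refine (measureReal_mono fun ω hω => ?_).trans hbern
          have hω' : T ≤ |inner ℝ u (J μ A b α n ω)| := hω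
          rw [inner_J] at hω'
          exact hT.trans hω'
      _ = δ := by ring
  -- Subadditivity over the two complementary events suffices, so neither has to be measurable.
  have hcover : (1 : ℝ) ≤ μ.real {ω | |inner ℝ u (J μ A b α n ω)| < T}
      + μ.real {ω | T ≤ |inner ℝ u (J μ A b α n ω)|} := by
    rw [← probReal_univ (μ := μ)]
    refine (measureReal_mono fun ω _ => ?_).trans (measureReal_union_le _ _)
    exact lt_or_ge |inner ℝ u (J μ A b α n ω)| T
  linarith
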